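/- Words over a finite linearly ordered alphabet $\Sigma$ are compared in radix order: $u<v$ if $|u|<|v|$, or if $|u|=|v|$ and $u$ is lexicographically smaller than $v$. For $L\subseteq\Sigma^*$ let \[ S(L)=\{u\in L : \forall v\in L,\ v<u \Rightarrow |v|<|u|\},\qquad B(L)=\{u\in L : \forall v\in L,\ v>u \Rightarrow |v|>|u|\} \] be the sets of the smallest, respectively largest, words of each length in $L$. DFAs are complete, and NFAs have a single initial state and no $\varepsilon$-transitions. For languages given by $n$-state DFAs, $2^{\Theta(\sqrt{n\log n})}$ states are, in general, necessary and sufficient for a DFA or an NFA to recognize $S(L)$, and likewise for $B(L)$. Precisely: there are absolute constants $c,C>0$ such that, for every finite linearly ordered alphabet $\Sigma$ and every integer $n\ge 2$, the following hold for each of the operations $X=S$ and $X=B$. 1. (Sufficiency) For every language $L\subseteq\Sigma^*$ that is recognized by a DFA with $n$ states, $X(L)$ is recognized by a DFA, and by an NFA, with at most $2^{C\sqrt{n\log n}}$ states. 2. (Necessity in general) If $|\Sigma|\ge 2$, then there is a language $L\subseteq\Sigma^*$ that is recognized by a DFA with $n$ states and such that every DFA and every NFA recognizing $X(L)$ has at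 least $2^{c\sqrt{n\log n}}$ states. -/

import Mathlib

/-- The smallest words of each length in `L`, with respect to the radix order (first by length, then
lexicographically), which is `List.Shortlex (· < ·)`. -/
def smallestWords {α : Type*} [LinearOrder α] (L : Language α) : Language α :=
  {u | u ∈ L ∧ ∀ v ∈ L, List.Shortlex (· < ·) v u → v.length < u.length}

/-- The largest words of each length in `L`, with respect to the radix order. -/
def largestWords {α : Type*} [LinearOrder α] (L : Language α) : Language α :=
  {u | u ∈ L ∧ ∀ v ∈ L, List.Shortlex (· < ·) u v → u.length < v.length}

/-- `L` is recognized by a (complete) DFA with exactly `m` states. -/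
def RecognizedByDFA {α : Type*} (L : Language α) (m : ℕ) : Prop :=
  ∃ M : DFA α (Fin m), M.accepts = L

/-- `L` is recognized by an NFA with exactly `m` states and a single initial state. -/
def RecognizedByNFA {α : Type*} (L : Language α) (m : ℕ) : Prop :=
  ∃ M : NFA α (Fin m), (∃ q₀, M.start = {q₀}) ∧ M.accepts = L

/-! Reversing the order of the letters exchanges $S$ and $B$, so both are instances of `minWords r`,
the lexicographically least words of each length for a relation `r` on letters. Upper bound: the
lengths of words accepted from a state are lengths of walks in the transition graph. They are
ultimately periodic with period $p$, the lcm of the shortest cycle lengths of the strongly connected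
components, times $2n$. Distinct such lengths come from disjoint components, so they sum to at most
$n$, and a Landau-type estimate gives $p\le e^{O(\sqrt{n\log n})}$. It remains to bound the number
of left quotients of `minWords r L` by a polynomial in $n$ and $p$ (`PeriodicFrom.leftQuotient_eq`).
Cut a long word as $u=u_0u_1$ with $|u_1|=N$, the preperiod. The suffix $u_1$ is determined by the
state after $u_0$ and one length for which it is a least prefix. What $u_0$ still contributes is the
set of residues mod $p$ of total lengths for which it starts the least word. Two such sets that meet
are nested, so one element and the cardinality determine the set. Lower bound: let $L$ contain all
$b^t$, together with words branching off after $b^i$ whose length is not divisible by a prime $p_i$.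
If the branching letter may be smaller than $b$, then for large $t$ the word $b^t$ is least exactly
when every $p_i$ divides $t$. Pumping then forces $\prod p_i$ states, even for an NFA, and the
primes are chosen of size about $\sqrt{n\log n}$ with sum below $n$. -/

/-- There is a walk with `t` steps from `x` to `y` in the directed graph `E`. -/
def Walk {σ : Type*} (E : σ → σ → Prop) : ℕ → σ → σ → Prop
  | 0, x, y => x = y
  | t + 1, x, y => ∃ z, E x z ∧ Walk E t z y

/-! ### Walks in finite directed graphs -/

namespace Walk

variable {σ : Type*} {E : σ → σ → Prop}

theorem refl (x : σ) : Walk E 0 x x := rfl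

theorem trans {s t : ℕ} {x y z : σ} (h₁ : Walk E s x y) (h₂ : Walk E t y z) :
    Walk E (s + t) x z := by
  induction s generalizing x with
  | zero => cases h₁; simpa using h₂
  | succ s ih =>
    obtain ⟨w, hw, h⟩ := h₁
    rw [show s + 1 + t = (s + t) + 1 by omega]
    exact ⟨w, hw, ih h⟩

theorem exists_of_add {s t : ℕ} {x z : σ} (h : Walk E (s + t) x z) :
    ∃ y, Walk E s x y ∧ Walk E t y z := by
  induction s generalizing x with
  | zero => exact ⟨x, rfl, by simpa using h⟩
  | succ s ih =>
    rw [show s + 1 + t = (s + t) + 1 by omega] at h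
    obtain ⟨w, hw, h⟩ := h
    obtain ⟨y, h₁, h₂⟩ := ih h
    exact ⟨y, ⟨w, hw, h₁⟩, h₂⟩

theorem iterate {t : ℕ} {x : σ} (h : Walk E t x x) (k : ℕ) : Walk E (k * t) x x := by
  induction k with
  | zero => simp [refl]
  | succ k ih => rw [Nat.succ_mul]; exact ih.trans h

/-- The vertices along a walk. -/
theorem exists_fun {t : ℕ} {x y : σ} (h : Walk E t x y) :
    ∃ f : ℕ → σ, f 0 = x ∧ f t = y ∧ ∀ i j, i ≤ j → j ≤ t → Walk E (j - i) (f i) (f j) := by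
  induction t generalizing y with
  | zero =>
    refine ⟨fun _ => x, rfl, h, fun i j _ _ => ?_⟩
    rw [show j - i = 0 by omega]
    exact rfl
  | succ t ih =>
    obtain ⟨z, h₁, h₂⟩ := h.exists_of_add
    obtain ⟨f, hf0, hft, hf⟩ := ih h₁
    refine ⟨fun i => if i ≤ t then f i else y, by simpa using hf0, by simp, fun i j hij hj => ?_⟩
    rcases Nat.lt_or_ge t j with htj | htj
    · obtain rfl : j = t + 1 := by omega
      rcases Nat.lt_or_ge t i with hti | hti
      · obtain rfl : i = t + 1 := by omega
        simp [refl]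
      · have := (hf i t hti le_rfl).trans (hft ▸ h₂)
        simp only [hti, if_true, show ¬ t + 1 ≤ t by omega, if_false]
        rwa [show t + 1 - i = t - i + 1 by omega]
    · simp only [htj, hij.trans htj, if_true]
      exact hf i j hij htj

variable [Fintype σ]

/-- Among the first `m * card σ + 1` vertices of a walk, one repeats after a number of steps divisible
by `m`. -/
theorem exists_closed_dvd {t m : ℕ} {x y : σ} (hm : 0 < m) (h : Walk E t x y)
    (ht : m * Fintype.card σ ≤ t) :
    ∃ z a b c, a + b ≤ m * Fintype.card σ ∧ 0 < b ∧ m ∣ b ∧ a + b + c = t ∧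
      Walk E a x z ∧ Walk E b z z ∧ Walk E c z y := by
  obtain ⟨f, rfl, rfl, hf⟩ := h.exists_fun
  -- Pigeonhole on pairs (time mod `m`, vertex): a repeated pair closes a walk of length divisible
  -- by `m`.
  let g : Fin (m * Fintype.card σ + 1) → Fin m × σ := fun i => (⟨i % m, Nat.mod_lt _ hm⟩, f i)
  have hg : ¬ Function.Injective g := fun hinj => by
    have := Fintype.card_le_of_injective g hinj
    simp at this
  obtain ⟨i, j, hij, hne⟩ : ∃ i j, g i = g j ∧ i < j := by
    simp only [Function.Injective, not_forall] at hg
    obtain ⟨i, j, hij, hne⟩ := hg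
    rcases lt_or_gt_of_ne hne with h | h
    · exact ⟨i, j, hij, h⟩
    · exact ⟨j, i, hij.symm, h⟩
  have hlt : (i : ℕ) < j := hne
  have hj := j.2
  simp only [g, Prod.mk.injEq, Fin.mk.injEq] at hij
  have h₂ := hf i j hlt.le (by omega)
  rw [← hij.2] at h₂
  refine ⟨f i, i, j - i, t - j, by omega, by omega, ?_, by omega, ?_, h₂, ?_⟩
  · exact (Nat.modEq_iff_dvd' hlt.le).1 hij.1
  · simpa using hf 0 i (by omega) (by omega)
  · rw [hij.2]; exact hf j t (by omega) le_rfl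

theorem exists_closed {t : ℕ} {x y : σ} (h : Walk E t x y) (ht : Fintype.card σ ≤ t) :
    ∃ z a b c, 0 < b ∧ b ≤ Fintype.card σ ∧ a + b + c = t ∧
      Walk E a x z ∧ Walk E b z z ∧ Walk E c z y := by
  obtain ⟨z, a, b, c, h1, h2, -, h3, h4⟩ := h.exists_closed_dvd one_pos (by simpa using ht)
  exact ⟨z, a, b, c, h2, by omega, h3, h4⟩

theorem exists_short {t : ℕ} {x y : σ} (h : Walk E t x y) :
    ∃ s ≤ Fintype.card σ, Walk E s x y := by
  induction t using Nat.strong_induction_on with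
  | _ t ih =>
    rcases Nat.lt_or_ge t (Fintype.card σ) with ht | ht
    · exact ⟨t, ht.le, h⟩
    · obtain ⟨z, a, b, c, hb, -, habc, h₁, -, h₃⟩ := h.exists_closed ht
      exact ih (a + c) (by omega) (h₁.trans h₃)

end Walk

/-! ### Periodicity of walk lengths -/

section Period

variable {σ : Type*} (E : σ → σ → Prop)

/-- The strongly connected component of `x` contains both `x` and `y`. -/
def StronglyConnected (x y : σ) : Prop := (∃ t, Walk E t x y) ∧ ∃ t, Walk E t y x

/-- The least length of a cycle in the strongly connected component of `x` (zero if there is none). -/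
noncomputable def cycleLength (x : σ) : ℕ :=
  sInf {t | 0 < t ∧ ∃ y, StronglyConnected E x y ∧ Walk E t y y}

/-- The lengths of the shortest cycles of the strongly connected components. -/
noncomputable def cycleLengths [Fintype σ] : Finset ℕ :=
  (Finset.univ.image (cycleLength E)).erase 0

variable {E}

theorem StronglyConnected.symm {x y : σ} (h : StronglyConnected E x y) :
    StronglyConnected E y x := ⟨h.2, h.1⟩

theorem StronglyConnected.trans {x y z : σ} (h : StronglyConnected E x y)
    (h' : StronglyConnected E y z) : StronglyConnected E x z := by
  obtain ⟨⟨a, ha⟩, ⟨b, hb⟩⟩ := h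
  obtain ⟨⟨c, hc⟩, ⟨d, hd⟩⟩ := h'
  exact ⟨⟨_, ha.trans hc⟩, ⟨_, hd.trans hb⟩⟩

theorem StronglyConnected.cycleLength_eq {x y : σ} (h : StronglyConnected E x y) :
    cycleLength E x = cycleLength E y := by
  unfold cycleLength
  congr 1
  ext t
  exact and_congr_right fun _ => exists_congr fun z => and_congr_left fun _ =>
    ⟨fun h' => h.symm.trans h', fun h' => h.trans h'⟩

theorem exists_walk_cycleLength {x : σ} (h : cycleLength E x ≠ 0) :
    ∃ y, StronglyConnected E x y ∧ Walk E (cycleLength E x) y y :=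
  (Nat.sInf_mem (Nat.nonempty_of_pos_sInf (Nat.pos_of_ne_zero h))).2

theorem cycleLength_le {x : σ} {t : ℕ} (ht : 0 < t) (h : Walk E t x x) : cycleLength E x ≤ t :=
  Nat.sInf_le ⟨ht, x, ⟨⟨0, rfl⟩, ⟨0, rfl⟩⟩, h⟩

theorem cycleLength_ne_zero {x : σ} {t : ℕ} (ht : 0 < t) (h : Walk E t x x) :
    cycleLength E x ≠ 0 := by
  have : {t | 0 < t ∧ ∃ y, StronglyConnected E x y ∧ Walk E t y y}.Nonempty :=
    ⟨t, ht, x, ⟨⟨0, rfl⟩, ⟨0, rfl⟩⟩, h⟩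
  exact (Nat.sInf_mem this).1.ne'

variable [Fintype σ]

-- A shortest cycle of a component repeats no vertex, and all its vertices share the same
-- `cycleLength`.
open Classical in
theorem le_card_cycleLength_eq {d : ℕ} (hd : d ∈ cycleLengths E) :
    d ≤ (Finset.univ.filter fun x => cycleLength E x = d).card := by
  simp only [cycleLengths, Finset.mem_erase, Finset.mem_image, Finset.mem_univ, true_and] at hd
  obtain ⟨hd0, x, rfl⟩ := hd
  obtain ⟨y, hxy, hy⟩ := exists_walk_cycleLength hd0
  obtain ⟨f, hf0, hfd, hf⟩ := hy.exists_fun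
  have hconn : ∀ i < cycleLength E x, StronglyConnected E x (f i) := fun i hi =>
    hxy.trans ⟨⟨i, by simpa [hf0] using hf 0 i (by omega) hi.le⟩,
      ⟨_, by simpa [hfd] using hf i _ hi.le le_rfl⟩⟩
  have hne : ∀ i j, i < j → j < cycleLength E x → f i ≠ f j := fun i j hij hj heq => by
    have h₁ := hf i j hij.le hj.le
    rw [← heq] at h₁
    have := cycleLength_le (by omega) h₁
    rw [← (hconn i (by omega)).cycleLength_eq] at this
    omega
  conv_lhs => rw [← Finset.card_range (cycleLength E x)]
  refine Finset.card_le_card_of_injOn f (fun i hi => ?_) fun i hi j hj hij => ?_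
  · simp only [Finset.coe_range, Set.mem_Iio] at hi
    simp [← (hconn i hi).cycleLength_eq]
  · simp only [Finset.coe_range, Set.mem_Iio] at hi hj
    rcases lt_trichotomy i j with h | h | h
    · exact absurd hij (hne i j h hj)
    · exact h
    · exact absurd hij.symm (hne j i h hi)

theorem sum_cycleLengths_le : ∑ d ∈ cycleLengths E, d ≤ Fintype.card σ := by
  classical
  calc ∑ d ∈ cycleLengths E, d
      ≤ ∑ d ∈ cycleLengths E, (Finset.univ.filter fun x => cycleLength E x = d).card :=
        Finset.sum_le_sum fun d hd => le_card_cycleLength_eq hd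
    _ = ((cycleLengths E).biUnion fun d => Finset.univ.filter fun x => cycleLength E x = d).card := by
        refine (Finset.card_biUnion fun d _ d' _ hne => ?_).symm
        simp only [Function.onFun, Finset.disjoint_left]
        intro x hx hx'
        simp only [Finset.mem_filter, Finset.mem_univ, true_and] at hx hx'
        exact hne (hx.symm.trans hx')
    _ ≤ Fintype.card σ := Finset.card_le_univ _

variable (E) in
/-- A period of the sets of lengths of walks. -/
noncomputable def walkPeriod : ℕ := (cycleLengths E).lcm id * (2 * Fintype.card σ)

theorem walkPeriod_pos [Nonempty σ] : 0 < walkPeriod E := by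
  refine Nat.mul_pos (Nat.pos_of_ne_zero fun h => ?_) (by have := Fintype.card_pos (α := σ); omega)
  obtain ⟨d, hd, h0⟩ := Finset.lcm_eq_zero_iff.1 h
  exact (Finset.mem_erase.1 hd).1 h0

/-- Make the detour from `x` to a shortest cycle (length `c`) and back, of length `a + b`, exactly
`c` times, so that its total length is a multiple of `c`. Turns of the cycle fill up the rest; the
factor `2 * card σ` leaves room for the detours. -/
theorem Walk.walkPeriod_of_closed {x : σ} {t : ℕ} (ht : 0 < t) (h : Walk E t x x) :
    Walk E (walkPeriod E) x x := by
  have hc := cycleLength_ne_zero ht h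
  obtain ⟨y, ⟨⟨a, ha⟩, ⟨b, hb⟩⟩, hy⟩ := exists_walk_cycleLength hc
  obtain ⟨a, ha', ha⟩ := ha.exists_short
  obtain ⟨b, hb', hb⟩ := hb.exists_short
  set c := cycleLength E x
  have hdvd : c ∣ (cycleLengths E).lcm id :=
    Finset.dvd_lcm (f := id) 
      (Finset.mem_erase.2 ⟨hc, Finset.mem_image_of_mem _ (Finset.mem_univ x)⟩)
  obtain ⟨e, he⟩ := hdvd
  have he0 : 0 < e := Nat.pos_of_ne_zero fun h0 => by
    rw [h0, mul_zero] at he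
    obtain ⟨d, hd, h0⟩ := Finset.lcm_eq_zero_iff.1 he
    exact (Finset.mem_erase.1 hd).1 h0
  have hle : a + b ≤ e * (2 * Fintype.card σ) :=
    le_trans (by omega) (Nat.le_mul_of_pos_left _ he0)
  have hw := ((ha.trans hb).iterate (c - 1)).trans
    ((ha.trans (hy.iterate (e * (2 * Fintype.card σ) - (a + b)))).trans hb)
  convert hw using 1
  rw [walkPeriod, he]
  obtain ⟨s, hs⟩ := Nat.exists_eq_add_of_le hle
  obtain ⟨c', hc'⟩ := Nat.exists_eq_succ_of_ne_zero hc
  change c = c' + 1 at hc'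
  rw [mul_assoc, hs, Nat.add_sub_cancel_left, hc', Nat.add_sub_cancel]
  ring

theorem Walk.add_walkPeriod {x y : σ} {t : ℕ} (h : Walk E t x y) (ht : Fintype.card σ ≤ t) (k : ℕ) :
    Walk E (t + k * walkPeriod E) x y := by
  obtain ⟨z, a, b, c, hb, -, habc, h₁, h₂, h₃⟩ := h.exists_closed ht
  have := (h₁.trans ((h₂.walkPeriod_of_closed hb).iterate k)).trans (h₂.trans h₃)
  convert this using 1
  omega

/-- The sets of lengths of walks are ultimately periodic. -/
theorem walk_add_walkPeriod_iff [Nonempty σ] {x y : σ} {t : ℕ}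
    (ht : (walkPeriod E + 1) * Fintype.card σ ≤ t) :
    Walk E (t + walkPeriod E) x y ↔ Walk E t x y := by
  rw [add_mul, one_mul] at ht
  refine ⟨fun h => ?_, fun h => by simpa using h.add_walkPeriod (by omega) 1⟩
  -- Remove a closed part whose length is a multiple `e * p` of the period `p`, short enough to
  -- leave `card σ` steps, then pump `e - 1` periods back in.
  obtain ⟨z, a, b, c, hab, hb, ⟨e, he⟩, habc, h₁, -, h₃⟩ :=
    h.exists_closed_dvd (walkPeriod_pos (E := E)) (by omega)
  have he0 : e ≠ 0 := by rintro rfl; omega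
  obtain ⟨e, rfl⟩ := Nat.exists_eq_succ_of_ne_zero he0
  have := (h₁.trans h₃).add_walkPeriod (by omega) e
  convert this using 1
  rw [Nat.mul_succ, mul_comm] at he
  omega

end Period

/-! ### Least words and lexicographic comparison at equal length -/

section MinWords

variable {α : Type*} (r : α → α → Prop)

/-- The words of `L` that are lexicographically least among the words of `L` of the same length. -/
def minWords (L : Language α) : Language α :=
  {u | u ∈ L ∧ ∀ v ∈ L, v.length = u.length → ¬ List.Lex r v u}

theorem lex_append_of_lex {r : α → α → Prop} {u v : List α} (huv : u.length = v.length)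
    (h : List.Lex r u v) (x y : List α) : List.Lex r (u ++ x) (v ++ y) := by
  induction h with
  | nil => simp at huv
  | cons _ ih => exact .cons (ih (by simpa using huv))
  | rel h => exact .rel h

theorem lex_or_of_lex_append {r : α → α → Prop} {u v x y : List α} (huv : u.length = v.length)
    (h : List.Lex r (u ++ x) (v ++ y)) : List.Lex r u v ∨ u = v ∧ List.Lex r x y := by
  induction u generalizing v with
  | nil =>
    cases v with
    | nil => exact .inr ⟨rfl, h⟩
    | cons b v => simp at huv
  | cons a u ih =>
    cases v with
    | nil => simp at huv
    | cons b v =>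
      rcases h with _ | h | h
      · exact .inl (.rel h)
      · rcases ih (by simpa using huv) h with h' | ⟨rfl, h'⟩
        · exact .inl (.cons h')
        · exact .inr ⟨rfl, h'⟩

theorem lex_trichotomy [Std.Trichotomous r] {u v : List α} (huv : u.length = v.length) :
    List.Lex r u v ∨ u = v ∨ List.Lex r v u := by
  induction u generalizing v with
  | nil => cases v with
    | nil => simp
    | cons b v => simp at huv
  | cons a u ih =>
    cases v with
    | nil => simp at huv
    | cons b v =>
      rcases trichotomous_of r a b with h | rfl | h
      · exact .inl (.rel h)
      · rcases ih (v := v) (by simpa using huv) with h | rfl | h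
        · exact .inl (.cons h)
        · exact .inr (.inl rfl)
        · exact .inr (.inr (.cons h))
      · exact .inr (.inr (.rel h))

theorem smallestWords_eq_minWords [LinearOrder α] (L : Language α) :
    smallestWords L = minWords (· < ·) L := by
  ext u
  refine and_congr_right fun _ => forall₂_congr fun v _ => ?_
  rw [List.shortlex_def]
  constructor
  · intro h hl hlex
    exact absurd (h (.inr ⟨hl, hlex⟩)) (by omega)
  · rintro h (hl | ⟨hl, hlex⟩)
    · exact hl
    · exact absurd hlex (h hl)

theorem lex_flip_iff {r : α → α → Prop} {u v : List α} (huv : u.length = v.length) :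
    List.Lex (fun a b => r b a) u v ↔ List.Lex r v u := by
  induction u generalizing v with
  | nil => cases v with
    | nil => simp
    | cons b v => simp at huv
  | cons a u ih =>
    cases v with
    | nil => simp at huv
    | cons b v =>
      have := ih (v := v) (by simpa using huv)
      constructor
      · rintro (_ | h | h)
        · exact .rel h
        · exact .cons (this.1 h)
      · rintro (_ | h | h)
        · exact .rel h
        · exact .cons (this.2 h)

theorem largestWords_eq_minWords [LinearOrder α] (L : Language α) :
    largestWords L = minWords (fun a b => b < a) L := by
  ext u
  refine and_congr_right fun _ => forall₂_congr fun v _ => ?_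
  rw [List.shortlex_def]
  constructor
  · intro h hl hlex
    exact absurd (h (.inr ⟨hl.symm, (lex_flip_iff hl).1 hlex⟩)) (by omega)
  · rintro h (hl | ⟨hl, hlex⟩)
    · exact hl
    · exact absurd ((lex_flip_iff hl.symm).2 hlex) (h hl.symm)

end MinWords

/-! ### Left quotients of the language of least words -/

namespace DFA

variable {α σ : Type*} (M : DFA α σ)

/-- Some word of length `l` leads from `q` to an accepting state. -/
def Completable (q : σ) (l : ℕ) : Prop := ∃ w : List α, w.length = l ∧ M.evalFrom q w ∈ M.accept

/-- Among the words accepted from `q` whose length exceeds that of `u` by `l`, the least one begins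
with `u`. -/
def IsMinPrefix (r : α → α → Prop) (q : σ) (u : List α) (l : ℕ) : Prop :=
  M.Completable (M.evalFrom q u) l ∧
    ∀ v : List α, v.length = u.length → List.Lex r v u → ¬ M.Completable (M.evalFrom q v) l

variable {M}

theorem completable_zero {q : σ} : M.Completable q 0 ↔ q ∈ M.accept := by
  simp [Completable]

theorem completable_iff_walk {q : σ} {l : ℕ} :
    M.Completable q l ↔ ∃ f ∈ M.accept, Walk (fun x y => ∃ a, M.step x a = y) l q f := by
  induction l generalizing q with
  | zero => simp [completable_zero, Walk]
  | succ l ih =>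
    have : M.Completable q (l + 1) ↔ ∃ a, M.Completable (M.step q a) l := by
      constructor
      · rintro ⟨_ | ⟨a, w⟩, hw, h⟩
        · simp at hw
        · exact ⟨a, w, by simpa using hw, by simpa using h⟩
      · rintro ⟨a, w, hw, h⟩
        exact ⟨a :: w, by simp [hw], by simpa using h⟩
    simp only [this, ih, Walk]
    constructor
    · rintro ⟨a, f, hf, h⟩
      exact ⟨f, hf, _, ⟨a, rfl⟩, h⟩
    · rintro ⟨f, hf, _, ⟨a, rfl⟩, h⟩
      exact ⟨a, f, hf, h⟩

variable {r : α → α → Prop}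

theorem mem_minWords_accepts_iff {u : List α} :
    u ∈ minWords r M.accepts ↔ M.IsMinPrefix r M.start u 0 := by
  simp only [IsMinPrefix, completable_zero]
  exact and_congr_right fun _ => ⟨fun h v hl hlex hv => h v hv hl hlex,
    fun h v hv hl hlex => h v hl hlex hv⟩

/-- Minimality is greedy: a comparison of words of equal length is settled on the first block unless
the blocks agree there, and then on the second. -/
theorem isMinPrefix_append_iff {q : σ} {u v : List α} {l : ℕ} :
    M.IsMinPrefix r q (u ++ v) l ↔
      M.IsMinPrefix r q u (v.length + l) ∧ M.IsMinPrefix r (M.evalFrom q u) v l := by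
  constructor
  · rintro ⟨⟨w, hw, hacc⟩, hmin⟩
    refine ⟨⟨⟨v ++ w, by simp [hw], ?_⟩, ?_⟩, ⟨w, hw, ?_⟩, ?_⟩
    · rwa [evalFrom_of_append] at hacc ⊢
    · rintro u' hu' hlex ⟨w', hw', hacc'⟩
      refine hmin (u' ++ w'.take v.length) (by simp [hu', hw']) (lex_append_of_lex hu' hlex _ _)
        ⟨w'.drop v.length, by simp [hw'], ?_⟩
      rwa [← evalFrom_of_append, List.append_assoc, List.take_append_drop, evalFrom_of_append]
    · rwa [evalFrom_of_append] at hacc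
    · rintro v' hv' hlex hc
      refine hmin (u ++ v') (by simp [hv']) (List.Lex.append_left r hlex u) ?_
      rwa [evalFrom_of_append]
  · rintro ⟨⟨-, hmin₁⟩, hc, hmin₂⟩
    refine ⟨by rwa [evalFrom_of_append], fun x hx hlex hc' => ?_⟩
    have hx' : (x.take u.length).length = u.length := by simp [hx]
    obtain ⟨x₁, x₂, rfl, hx₁⟩ : ∃ x₁ x₂, x = x₁ ++ x₂ ∧ x₁.length = u.length :=
      ⟨_, _, (List.take_append_drop u.length x).symm, hx'⟩
    have hx₂ : x₂.length = v.length := by simpa [hx₁] using hx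
    rw [evalFrom_of_append] at hc'
    rcases lex_or_of_lex_append hx₁ hlex with h | ⟨rfl, h⟩
    · obtain ⟨w, hw, hacc⟩ := hc'
      exact hmin₁ x₁ hx₁ h ⟨x₂ ++ w, by simp [hx₂, hw], by rwa [evalFrom_of_append]⟩
    · exact hmin₂ x₂ hx₂ h hc'

theorem IsMinPrefix.eq [Std.Trichotomous r] {q : σ} {u v : List α} {l : ℕ}
    (hu : M.IsMinPrefix r q u l) (hv : M.IsMinPrefix r q v l) (huv : u.length = v.length) :
    u = v := by
  rcases lex_trichotomy r huv with h | h | h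
  · exact absurd hu.1 (hv.2 u huv h)
  · exact h
  · exact absurd hv.1 (hu.2 v huv.symm h)

variable (M) in
/-- From `N` on, the set of lengths of words accepted from any state is periodic with period `p`. -/
def PeriodicFrom (N p : ℕ) : Prop :=
  ∀ q, ∀ l ≥ N, M.Completable q (l + p) ↔ M.Completable q l

variable {N p : ℕ}

/-- `IsMinPrefix` depends on `l` only through completability, which is periodic from `N` on. -/
theorem PeriodicFrom.isMinPrefix_iff (hM : M.PeriodicFrom N p) {q : σ} {u : List α} {l l' : ℕ}
    (hl : N ≤ l) (hl' : N ≤ l') (h : l % p = l' % p) :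
    M.IsMinPrefix r q u l ↔ M.IsMinPrefix r q u l' := by
  have key : ∀ k l, N ≤ l → (M.IsMinPrefix r q u (l + p * k) ↔ M.IsMinPrefix r q u l) := by
    intro k
    induction k with
    | zero => simp
    | succ k ih =>
      intro l hl
      rw [← ih l hl, Nat.mul_succ, ← add_assoc]
      unfold IsMinPrefix
      rw [hM _ _ (by omega)]
      exact and_congr_right fun _ => forall₃_congr fun v _ _ => not_congr (hM _ _ (by omega))
  wlog hle : l ≤ l' generalizing l l'
  · exact (this hl' hl h.symm (by omega)).symm
  obtain ⟨k, hk⟩ := (Nat.modEq_iff_dvd' hle).1 h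
  obtain rfl : l' = l + p * k := by omega
  exact (key k l hl).symm

theorem PeriodicFrom.exists_isMinPrefix_lt (hM : M.PeriodicFrom N p) (hp : 0 < p) {q : σ}
    {u : List α} {l : ℕ} (h : M.IsMinPrefix r q u l) : ∃ l' < N + p, M.IsMinPrefix r q u l' := by
  rcases Nat.lt_or_ge l N with hl | hl
  · exact ⟨l, by omega, h⟩
  · have := Nat.mod_lt (l - N) hp
    refine ⟨N + (l - N) % p, by omega, (hM.isMinPrefix_iff hl (by omega) ?_).1 h⟩
    rw [Nat.add_mod_mod, Nat.add_sub_cancel' hl]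

variable (M r N p) in
/-- The residues modulo `p` of the total lengths, exceeding `u.length` by at least `N`, for which `u`
is a prefix of the least accepted word. -/
def residues (u : List α) : Set ℕ :=
  {c | ∃ l ≥ N, (u.length + l) % p = c ∧ M.IsMinPrefix r M.start u l}

theorem mem_residues_of_append {u v : List α} {c : ℕ} (h : c ∈ M.residues r N p (u ++ v)) :
    c ∈ M.residues r N p u := by
  obtain ⟨l, hl, hc, h⟩ := h
  exact ⟨v.length + l, by omega, by rw [← hc, List.length_append, add_assoc],
    (isMinPrefix_append_iff.1 h).1⟩

theorem residues_subset (hp : 0 < p) (u : List α) : M.residues r N p u ⊆ Set.Iio p := by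
  rintro c ⟨l, -, rfl, -⟩
  exact Nat.mod_lt _ hp

/-- Least prefixes of a given length are unique within the class `c`, so `u` is a prefix of `v`;
extending a word can only lose residues. -/
theorem PeriodicFrom.residues_subset_of_le [Std.Trichotomous r] (hM : M.PeriodicFrom N p)
    {u v : List α} {c : ℕ} (huv : u.length ≤ v.length) (hu : c ∈ M.residues r N p u)
    (hv : c ∈ M.residues r N p v) : M.residues r N p v ⊆ M.residues r N p u := by
  obtain ⟨v₁, v₂, rfl, hv₁⟩ : ∃ v₁ v₂, v = v₁ ++ v₂ ∧ v₁.length = u.length :=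
    ⟨_, _, (List.take_append_drop u.length v).symm, by simp [huv]⟩
  obtain ⟨l, hl, hc, h⟩ := hu
  obtain ⟨l', hl', hc', h'⟩ := mem_residues_of_append hv
  have hll : l % p = l' % p := by
    rw [← hc', hv₁] at hc
    exact Nat.ModEq.add_left_cancel' u.length hc
  obtain rfl := h.eq ((hM.isMinPrefix_iff hl hl' hll).2 h') hv₁.symm
  exact fun _ => mem_residues_of_append

theorem PeriodicFrom.residues_eq [Std.Trichotomous r] (hM : M.PeriodicFrom N p) (hp : 0 < p)
    {u v : List α} {c : ℕ} (hu : c ∈ M.residues r N p u) (hv : c ∈ M.residues r N p v)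
    (hcard : (M.residues r N p u).ncard = (M.residues r N p v).ncard) :
    M.residues r N p u = M.residues r N p v := by
  have hfin : ∀ w, (M.residues r N p w).Finite := fun w =>
    (Set.finite_Iio p).subset (residues_subset hp w)
  rcases le_total u.length v.length with h | h
  · exact (Set.eq_of_subset_of_ncard_le (hM.residues_subset_of_le h hu hv) hcard.le (hfin u)).symm
  · exact Set.eq_of_subset_of_ncard_le (hM.residues_subset_of_le h hv hu) hcard.ge (hfin v)

theorem PeriodicFrom.mem_residues_iff (hM : M.PeriodicFrom N p) {u : List α} {l : ℕ} (hl : N ≤ l) :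
    (u.length + l) % p ∈ M.residues r N p u ↔ M.IsMinPrefix r M.start u l := by
  refine ⟨fun ⟨l', hl', hc, h⟩ => ?_, fun h => ⟨l, hl, rfl, h⟩⟩
  exact (hM.isMinPrefix_iff hl' hl (Nat.ModEq.add_left_cancel' u.length hc)).1 h

theorem leftQuotient_minWords_append (u v : List α) :
    (minWords r M.accepts).leftQuotient (u ++ v) =
      {w | M.IsMinPrefix r M.start u (v.length + w.length) ∧
        M.IsMinPrefix r (M.eval u) (v ++ w) 0} := by
  ext w
  rw [Language.mem_leftQuotient, mem_minWords_accepts_iff, List.append_assoc,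
    isMinPrefix_append_iff, List.length_append, add_zero]
  rfl

variable (M r N p) in
/-- A description, by one of boundedly many values, of the left quotient by `u` of the language of
least words. -/
def Describes (u : List α) :
    Unit ⊕ (Fin N × Fin (N + p)) ⊕ (σ × Fin p × Fin p × Fin (p + 1) × Fin (N + p)) → Prop
  | .inl _ => ∀ w, w ∉ (minWords r M.accepts).leftQuotient u
  | .inr (.inl (k, l)) => u.length = k ∧ M.IsMinPrefix r M.start u l
  | .inr (.inr (q, a, c, s, l)) => ∃ u₀ u₁, u = u₀ ++ u₁ ∧ u₁.length = N ∧ M.eval u₀ = q ∧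
      u₀.length % p = a ∧ (c : ℕ) ∈ M.residues r N p u₀ ∧ (M.residues r N p u₀).ncard = s ∧
      M.IsMinPrefix r q u₁ l

theorem PeriodicFrom.exists_describes (hM : M.PeriodicFrom N p) (hp : 0 < p) (u : List α) :
    ∃ d, M.Describes r N p u d := by
  by_cases hu : ∀ w, w ∉ (minWords r M.accepts).leftQuotient u
  · exact ⟨.inl (), hu⟩
  simp only [not_forall, not_not] at hu
  obtain ⟨w, hw⟩ := hu
  rw [Language.mem_leftQuotient, mem_minWords_accepts_iff, isMinPrefix_append_iff] at hw
  replace hw := hw.1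
  rcases Nat.lt_or_ge u.length N with hN | hN
  · obtain ⟨l, hl, h⟩ := hM.exists_isMinPrefix_lt hp hw
    exact ⟨.inr (.inl (⟨_, hN⟩, ⟨l, hl⟩)), rfl, h⟩
  · obtain ⟨u₀, u₁, rfl, hu₁⟩ : ∃ u₀ u₁, u = u₀ ++ u₁ ∧ u₁.length = N :=
      ⟨_, _, (List.take_append_drop (u.length - N) u).symm, by simp; omega⟩
    rw [isMinPrefix_append_iff] at hw
    obtain ⟨l, hl, h⟩ := hM.exists_isMinPrefix_lt hp hw.2
    have hcard := Set.ncard_le_ncard (residues_subset (M := M) (r := r) (N := N) hp u₀)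
      (Set.finite_Iio p)
    rw [← Finset.coe_Iio, Set.ncard_coe_finset, Nat.card_Iio] at hcard
    exact ⟨.inr (.inr (M.eval u₀, ⟨_, Nat.mod_lt _ hp⟩, ⟨_, Nat.mod_lt _ hp⟩,
      ⟨(M.residues r N p u₀).ncard, by omega⟩, ⟨l, hl⟩)), u₀, u₁, rfl, hu₁, rfl, rfl,
      (hM.mem_residues_iff (by omega)).2 hw.1, rfl, h⟩

theorem PeriodicFrom.leftQuotient_eq [Std.Trichotomous r] (hM : M.PeriodicFrom N p) (hp : 0 < p)
    {u v : List α} {d} (hu : M.Describes r N p u d) (hv : M.Describes r N p v d) :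
    (minWords r M.accepts).leftQuotient u = (minWords r M.accepts).leftQuotient v := by
  rcases d with _ | ⟨k, l⟩ | ⟨q, a, c, s, l⟩
  · ext w
    exact iff_of_false (hu w) (hv w)
  · rw [hu.2.eq hv.2 (hu.1.trans hv.1.symm)]
  · obtain ⟨u₀, u₁, rfl, hu₁, hq, ha, hc, hs, h⟩ := hu
    obtain ⟨v₀, v₁, rfl, hv₁, hq', ha', hc', hs', h'⟩ := hv
    obtain rfl := h.eq h' (hu₁.trans hv₁.symm)
    have hres := hM.residues_eq hp hc hc' (hs.trans hs'.symm)
    rw [leftQuotient_minWords_append, leftQuotient_minWords_append, hq, hq']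
    ext w
    refine and_congr_left fun _ => ?_
    rw [← hM.mem_residues_iff (by omega), ← hM.mem_residues_iff (by omega), hres,
      Nat.ModEq.add_right (u₁.length + w.length) (ha.trans ha'.symm : u₀.length ≡ v₀.length [MOD p])]

end DFA

/-! ### From quotients to automata; state bounds for powers of a letter -/

theorem card_range_le_of_describes {X Y β : Type*} [Fintype β] {f : X → Y} {D : X → β → Prop}
    (hD : ∀ x, ∃ d, D x d) (hf : ∀ x x' d, D x d → D x' d → f x = f x') :
    (Set.range f).Finite ∧ Nat.card (Set.range f) ≤ Fintype.card β := by
  choose g hg using hD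
  choose x hx using fun y : Set.range f => y.2
  have hinj : Function.Injective fun y => g (x y) := fun y y' h => by
    apply Subtype.ext
    rw [← hx y, ← hx y']
    refine hf _ _ _ (hg _) ?_
    simp only at h
    rw [h]
    exact hg _
  refine ⟨Finite.of_injective _ hinj, ?_⟩
  rw [← Nat.card_eq_fintype_card]
  exact Nat.card_le_card_of_injective _ hinj

theorem RecognizedByDFA.of_dfa {α σ : Type*} [Finite σ] (M : DFA α σ) :
    RecognizedByDFA M.accepts (Nat.card σ) :=
  ⟨DFA.reindex (Finite.equivFin σ) M, DFA.accepts_reindex _ _⟩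

theorem RecognizedByDFA.nfa {α : Type*} {L : Language α} {m : ℕ} (h : RecognizedByDFA L m) :
    RecognizedByNFA L m := by
  obtain ⟨M, rfl⟩ := h
  exact ⟨M.toNFA, ⟨M.start, rfl⟩, M.toNFA_correct⟩

theorem DFA.periodicFrom_walkPeriod {α σ : Type*} [Fintype σ] [Nonempty σ] (M : DFA α σ) :
    M.PeriodicFrom ((walkPeriod (fun x y => ∃ a, M.step x a = y) + 1) * Fintype.card σ)
      (walkPeriod fun x y => ∃ a, M.step x a = y) := by
  intro q l hl
  simp only [completable_iff_walk]
  exact exists_congr fun f => and_congr_right fun _ => walk_add_walkPeriod_iff hl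

theorem exists_recognizedByDFA_minWords {α : Type*} (r : α → α → Prop) [Std.Trichotomous r]
    {n : ℕ} (hn : 0 < n) (M : DFA α (Fin n)) :
    ∃ p N m, p = walkPeriod (fun x y => ∃ a, M.step x a = y) ∧ N = (p + 1) * n ∧
      m ≤ 1 + (N * (N + p) + n * (p * (p * ((p + 1) * (N + p))))) ∧
      RecognizedByDFA (minWords r M.accepts) m := by
  have : Nonempty (Fin n) := ⟨⟨0, hn⟩⟩
  have hM := M.periodicFrom_walkPeriod
  have hp : 0 < walkPeriod (fun x y => ∃ a, M.step x a = y) := walkPeriod_pos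
  obtain ⟨hfin, hcard⟩ := card_range_le_of_describes (hM.exists_describes (r := r) hp)
    fun _ _ _ h h' => hM.leftQuotient_eq hp h h'
  have : Finite (Set.range (minWords r M.accepts).leftQuotient) := hfin
  refine ⟨_, _, _, rfl, rfl, ?_, (minWords r M.accepts).accepts_toDFA ▸
    RecognizedByDFA.of_dfa (minWords r M.accepts).toDFA⟩
  simpa using hcard

theorem RecognizedByDFA.mono {α : Type*} {L : Language α} {m n : ℕ} (h : RecognizedByDFA L m)
    (hmn : m ≤ n) : RecognizedByDFA L n := by
  obtain ⟨M, rfl⟩ := h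
  obtain ⟨j, rfl⟩ := Nat.exists_eq_add_of_le hmn
  -- The `j` extra states are unreachable; their transitions are arbitrary.
  let M' : DFA α (Fin m ⊕ Fin j) :=
    { step := fun q a => .inl (M.step (q.elim id fun _ => M.start) a)
      start := .inl M.start
      accept := Sum.inl '' M.accept }
  have heval : ∀ q w, M'.evalFrom (.inl q) w = .inl (M.evalFrom q w) := by
    intro q w
    induction w generalizing q with
    | nil => rfl
    | cons a w ih =>
      rw [DFA.evalFrom_cons, DFA.evalFrom_cons]
      exact ih _
  have hM' : M'.accepts = M.accepts := by
    ext w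
    rw [DFA.mem_accepts, DFA.mem_accepts, DFA.eval, DFA.eval]
    change M'.evalFrom (.inl M.start) w ∈ Sum.inl '' M.accept ↔ _
    rw [heval, Function.Injective.mem_set_image Sum.inl_injective]
  have := RecognizedByDFA.of_dfa M'
  rwa [hM', Nat.card_sum, Nat.card_fin, Nat.card_fin] at this

theorem NFA.mem_evalFrom_replicate_iff {α σ : Type*} (M : NFA α σ) (b : α) {t : ℕ} {S : Set σ}
    {y : σ} : y ∈ M.evalFrom S (List.replicate t b) ↔
      ∃ x ∈ S, Walk (fun x y => y ∈ M.step x b) t x y := by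
  induction t generalizing S with
  | zero => simp [Walk]
  | succ t ih =>
    simp only [List.replicate_succ, NFA.evalFrom_cons, ih, NFA.mem_stepSet, Walk]
    constructor
    · rintro ⟨x, ⟨z, hz, hzx⟩, h⟩
      exact ⟨z, hz, x, hzx, h⟩
    · rintro ⟨z, hz, x, hzx, h⟩
      exact ⟨x, ⟨z, hz, hzx⟩, h⟩

/-- An automaton whose language contains the powers of `b` with exponents divisible by `P`, and no other
long powers of `b`, has at least `P` states. -/
theorem RecognizedByNFA.le_of_replicate {α : Type*} {K : Language α} {m P k : ℕ} {b : α}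
    (h : RecognizedByNFA K m) (h₁ : ∀ t, P ∣ t → List.replicate t b ∈ K)
    (h₂ : ∀ t, k ≤ t → List.replicate t b ∈ K → P ∣ t) : P ≤ m := by
  obtain ⟨M, -, rfl⟩ := h
  rcases Nat.eq_zero_or_pos P with rfl | hP
  · exact Nat.zero_le _
  have hmem : ∀ t, List.replicate t b ∈ M.accepts ↔
      ∃ f ∈ M.accept, ∃ s ∈ M.start, Walk (fun x y => y ∈ M.step x b) t s f := fun t => by
    simp only [NFA.mem_accepts, NFA.mem_evalFrom_replicate_iff]
  have hle : k + m ≤ P * (k + m) := Nat.le_mul_of_pos_left _ hP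
  obtain ⟨f, hf, s, hs, hw⟩ := (hmem _).1 (h₁ (P * (k + m)) (dvd_mul_right _ _))
  obtain ⟨z, c, d, e, hd, hdm, hsum, hw₁, hw₂, hw₃⟩ := hw.exists_closed (by simp; omega)
  rw [Fintype.card_fin] at hdm
  -- Repeating a cycle of length `d ≤ m` once more keeps the word accepted, so `P` divides `d`.
  have hdvd := h₂ (c + (d + d) + e) (by omega)
    ((hmem _).2 ⟨f, hf, s, hs, (hw₁.trans (hw₂.trans hw₂)).trans hw₃⟩)
  rw [show c + (d + d) + e = P * (k + m) + d by omega, Nat.dvd_add_right (dvd_mul_right _ _)] at hdvd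
  exact (Nat.le_of_dvd hd hdvd).trans hdm

theorem not_lex_self {α : Type*} {r : α → α → Prop} [Std.Irrefl r] (u : List α) :
    ¬ List.Lex r u u := by
  induction u with
  | nil => exact List.not_lex_nil
  | cons a u ih => exact fun h => ih (List.lex_cons_iff.1 h)

/-! ### The automaton for the lower bound -/

section Branching

variable {α : Type*} [DecidableEq α] {k : ℕ}

/-- An automaton accepting all powers of `b`, together with the words `b ^ i c w` with `i < k` and
`c ≠ b` whose length is not divisible by `p i`. -/
def branchingDFA (b : α) (p : Fin k → ℕ) : DFA α (Option (Fin (k + 1) ⊕ Σ i, ZMod (p i))) where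
  step
    | none, _ => none
    | some (.inl i), c =>
      if h : (i : ℕ) < k then
        -- The counter starts at `i + 1`, the number of letters read so far, so it always holds the
        -- full length mod `p i`.
        if c = b then some (.inl ⟨i + 1, by omega⟩) else some (.inr ⟨⟨i, h⟩, ((i + 1 : ℕ) : ZMod _)⟩)
      else if c = b then some (.inl i) else none
    | some (.inr ⟨i, z⟩), _ => some (.inr ⟨i, z + 1⟩)
  start := some (.inl 0)
  accept := {q | ∃ s, q = some s ∧ ∀ i z, s = .inr ⟨i, z⟩ → z ≠ 0}

variable (b : α) (p : Fin k → ℕ)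

theorem branchingDFA_eval_replicate (t : ℕ) :
    (branchingDFA b p).eval (List.replicate t b) = some (.inl ⟨min t k, by omega⟩) := by
  induction t with
  | zero => simp; rfl
  | succ t ih =>
    rw [List.replicate_succ', DFA.eval_append_singleton, ih]
    simp only [branchingDFA, if_true]
    split <;> simp only [Option.some.injEq, Sum.inl.injEq, Fin.mk.injEq] <;> omega

theorem branchingDFA_eval_branch {a : α} (hab : a ≠ b) (i : Fin k) (t : ℕ) :
    (branchingDFA b p).eval (List.replicate i b ++ a :: List.replicate t b) =
      some (.inr ⟨i, ((i + 1 + t : ℕ) : ZMod _)⟩) := by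
  induction t with
  | zero =>
    rw [List.replicate_zero, DFA.eval_append_singleton, branchingDFA_eval_replicate]
    simp [branchingDFA, hab]
  | succ t ih =>
    rw [List.replicate_succ', ← List.cons_append, ← List.append_assoc, DFA.eval_append_singleton, ih]
    simp [branchingDFA, add_assoc]

theorem branchingDFA_eval_inl {w : List α} {i : Fin (k + 1)}
    (h : (branchingDFA b p).eval w = some (.inl i)) : w = List.replicate w.length b := by
  induction w using List.reverseRecOn generalizing i with
  | nil => rfl
  | append_singleton w c ih =>
    rw [DFA.eval_append_singleton] at h
    rcases hw : (branchingDFA b p).eval w with _ | j | j <;> rw [hw] at h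
    · simp [branchingDFA] at h
    · have hc : c = b := by
        by_contra hc
        simp only [branchingDFA, hc, if_false] at h
        split at h <;> simp at h
      rw [List.length_append, List.length_singleton, List.replicate_succ', ← ih hw, hc]
    · simp [branchingDFA] at h

theorem branchingDFA_eval_inr {w : List α} {i : Fin k} {z : ZMod (p i)}
    (h : (branchingDFA b p).eval w = some (.inr ⟨i, z⟩)) : z = (w.length : ZMod (p i)) := by
  induction w using List.reverseRecOn generalizing i with
  | nil => simp [branchingDFA] at h
  | append_singleton w c ih =>
    rw [DFA.eval_append_singleton] at h
    rcases hw : (branchingDFA b p).eval w with _ | j | ⟨j, y⟩ <;> rw [hw] at h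
    · simp [branchingDFA] at h
    · have hwl := branchingDFA_eval_inl b p hw
      rw [hwl, branchingDFA_eval_replicate] at hw
      simp only [Option.some.injEq, Sum.inl.injEq] at hw
      subst hw
      by_cases hk : w.length < k
      · by_cases hc : c = b
        · simp [branchingDFA, hk, hc] at h
        · simp only [branchingDFA, hk, inf_lt_right, not_le, dif_pos, hc, if_false,
            Option.some.injEq, Sum.inr.injEq] at h
          cases h
          simp [min_eq_left hk.le]
      · by_cases hc : c = b <;> simp [branchingDFA, hk, hc] at h
    · simp only [branchingDFA, Option.some.injEq, Sum.inr.injEq] at h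
      cases h
      simp [ih hw]

variable {b p} {r : α → α → Prop} {a : α}

theorem replicate_mem_minWords_branchingDFA [Std.Irrefl r] {t : ℕ} (ht : ∀ i, p i ∣ t) :
    List.replicate t b ∈ minWords r (branchingDFA b p).accepts := by
  refine ⟨?_, fun v hv hl hlex => ?_⟩
  · rw [DFA.mem_accepts, branchingDFA_eval_replicate]
    exact ⟨_, rfl, by simp⟩
  · rw [List.length_replicate] at hl
    rw [DFA.mem_accepts] at hv
    obtain ⟨i | ⟨i, z⟩, hs, hz⟩ := hv
    · rw [branchingDFA_eval_inl b p hs, hl] at hlex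
      exact not_lex_self _ hlex
    · refine hz i z rfl ?_
      rw [branchingDFA_eval_inr b p hs, hl]
      exact (ZMod.natCast_eq_zero_iff _ _).2 (ht i)

/-- If `p i` does not divide `t`, replacing the letter of `b ^ t` at position `i` by the smaller `a`
yields an accepted word. The bound `k ≤ t` ensures that this position exists. -/
theorem dvd_of_replicate_mem_minWords (hab : a ≠ b) (hr : r a b) {t : ℕ} (hk : k ≤ t)
    (h : List.replicate t b ∈ minWords r (branchingDFA b p).accepts) (i : Fin k) : p i ∣ t := by
  by_contra hi
  obtain ⟨s, rfl⟩ : ∃ s, t = i + (1 + s) := ⟨t - i - 1, by omega⟩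
  refine h.2 (List.replicate i b ++ a :: List.replicate s b) ?_ (by simp; omega) ?_
  · rw [DFA.mem_accepts, branchingDFA_eval_branch b p hab]
    refine ⟨_, rfl, ?_⟩
    rintro j z hz
    cases hz
    rw [Ne, ZMod.natCast_eq_zero_iff]
    rwa [add_assoc]
  · rw [List.replicate_add, List.replicate_add]
    exact List.Lex.append_left r (.rel hr) _

theorem exists_language_prod_le [Std.Irrefl r] (hab : a ≠ b) (hr : r a b) (hp : ∀ i, 0 < p i)
    (hcop : Pairwise fun i j => (p i).Coprime (p j)) {n : ℕ} (hn : k + 2 + ∑ i, p i ≤ n) :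
    ∃ L : Language α, RecognizedByDFA L n ∧
      ∀ m, RecognizedByNFA (minWords r L) m → ∏ i, p i ≤ m := by
  have : ∀ i, NeZero (p i) := fun i => ⟨(hp i).ne'⟩
  refine ⟨(branchingDFA b p).accepts, (RecognizedByDFA.of_dfa _).mono ?_, fun m hm => ?_⟩
  · simp only [Nat.card_eq_fintype_card, Fintype.card_option, Fintype.card_sum, Fintype.card_fin,
      Fintype.card_sigma, ZMod.card]
    omega
  · refine hm.le_of_replicate (b := b) (k := k) (fun t ht => ?_) fun t hk ht => ?_
    · exact replicate_mem_minWords_branchingDFA fun i =>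
        (Finset.dvd_prod_of_mem p (Finset.mem_univ i)).trans ht
    · exact Fintype.prod_dvd_of_isRelPrime (fun i j hij => Nat.coprime_iff_isRelPrime.1 (hcop hij))
        (dvd_of_replicate_mem_minWords hab hr hk ht)

end Branching

/-- Serves the finitely many small `n`. For the language of nonempty words, `[a]` is least but the
empty word is excluded, and a one-state NFA accepting `[a]` would accept the empty word. -/
theorem exists_language_two_le {α : Type*} {r : α → α → Prop} {a : α} (ha : ∀ c, ¬ r c a) {n : ℕ}
    (hn : 2 ≤ n) : ∃ L : Language α, RecognizedByDFA L n ∧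
      ∀ m, RecognizedByNFA (minWords r L) m → 2 ≤ m := by
  let M : DFA α Bool := ⟨fun _ _ => true, false, {true}⟩
  refine ⟨M.accepts, (RecognizedByDFA.of_dfa M).mono (by simpa using hn), ?_⟩
  rintro m ⟨M', ⟨q₀, hq₀⟩, hM'⟩
  have h0 : [] ∉ minWords r M.accepts := fun h => by
    simpa [M, DFA.mem_accepts] using h.1
  have h1 : [a] ∈ minWords r M.accepts := by
    refine ⟨rfl, fun v _ hl hlex => ?_⟩
    obtain ⟨c, rfl⟩ := List.length_eq_one_iff.1 hl
    exact ha c ((List.lex_singleton_iff c a).1 hlex)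
  rw [← hM', NFA.mem_accepts] at h0 h1
  obtain ⟨q, hq, -⟩ := h1
  by_contra hm
  have : Subsingleton (Fin m) := Fin.subsingleton_iff_le_one.2 (by omega)
  exact h0 ⟨q, hq, by simp [hq₀, Subsingleton.elim q q₀]⟩

/-! ### Growth of the least common multiple -/

theorem lcm_dvd_lcmUpto_mul (D : Finset ℕ) (Y : ℕ) (hD : 0 ∉ D) :
    D.lcm id ∣ Nat.lcmUpto Y * ∏ d ∈ D with Y < d, d := by
  refine Finset.lcm_dvd fun d hd => ?_
  rcases Nat.lt_or_ge Y d with h | h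
  · exact (Finset.dvd_prod_of_mem (fun d => d) (Finset.mem_filter.2 ⟨hd, h⟩)).mul_left _
  · refine Dvd.dvd.mul_right ?_ _
    have : d ≠ 0 := fun h0 => hD (h0 ▸ hd)
    exact Finset.dvd_lcm (f := id) (Finset.mem_Icc.2 ⟨by omega, h⟩)

section Growth

variable {n : ℕ}

theorem one_le_sqrt_mul_log (hn : 2 ≤ n) : 1 ≤ √(n * Real.log n) := by
  have hn' : (2 : ℝ) ≤ n := by exact_mod_cast hn
  have hlog : Real.log 2 ≤ Real.log n := Real.log_le_log (by norm_num) hn'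
  have := Real.log_two_gt_d9
  rw [Real.one_le_sqrt]
  nlinarith

theorem log_le_sqrt_mul_log : Real.log n ≤ √(n * Real.log n) := by
  refine Real.le_sqrt_of_sq_le ?_
  rw [sq]
  exact mul_le_mul_of_nonneg_right (Real.log_le_self (Nat.cast_nonneg n)) (Real.log_natCast_nonneg n)

theorem natCast_le_exp_sqrt (hn : 2 ≤ n) : (n : ℝ) ≤ Real.exp √(n * Real.log n) :=
  (Real.log_le_iff_le_exp (by exact_mod_cast (by omega : 0 < n))).1 log_le_sqrt_mul_log

/-- The least common multiple of distinct positive integers with sum at most `n`. -/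
theorem lcm_le_exp_of_sum_le (hn : 2 ≤ n) {D : Finset ℕ} (hD : 0 ∉ D) (hsum : ∑ d ∈ D, d ≤ n) :
    ((D.lcm id : ℕ) : ℝ) ≤ Real.exp √(n * Real.log n) ^ 13 := by
  set y := √(n * Real.log n) with hy
  have hy1 : 1 ≤ y := one_le_sqrt_mul_log hn
  have hyy : y * y = n * Real.log n :=
    Real.mul_self_sqrt (mul_nonneg (Nat.cast_nonneg n) (Real.log_natCast_nonneg n))
  have hn0 : (0 : ℝ) < n := by exact_mod_cast (by omega : 0 < n)
  -- Threshold balancing both parts: the lcm of numbers up to `Y` is $e^{\psi(Y)}=e^{O(y)}$ by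
  -- Chebyshev, while at most $n/y$ elements exceed `Y`, with product at most $n^{n/y}=e^y$.
  set Y := ⌈y⌉₊
  have hY : y ≤ Y := Nat.le_ceil y
  have hY' : (Y : ℝ) < y + 1 := Nat.ceil_lt_add_one (by linarith)
  set F := D.filter (Y < ·)
  have hcard : F.card * Y ≤ n := calc
    F.card * Y ≤ ∑ d ∈ F, d :=
      Finset.card_nsmul_le_sum F _ _ fun d hd => (Finset.mem_filter.1 hd).2.le
    _ ≤ ∑ d ∈ D, d := Finset.sum_le_sum_of_subset (Finset.filter_subset _ _)
    _ ≤ n := hsum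
  have hprod : ∏ d ∈ F, d ≤ n ^ F.card :=
    Finset.prod_le_pow_card _ _ _ fun d hd =>
      (Finset.single_le_sum (f := fun d => d) (fun _ _ => Nat.zero_le _)
        (Finset.mem_of_mem_filter d hd)).trans hsum
  have hlarge : ((n : ℝ) ^ F.card) ≤ Real.exp y := by
    rw [← Real.log_le_iff_le_exp (by positivity), Real.log_pow]
    have hc : (F.card : ℝ) * Y ≤ n := by exact_mod_cast hcard
    have hc' : (F.card : ℝ) * y ≤ n :=
      (mul_le_mul_of_nonneg_left hY (Nat.cast_nonneg _)).trans hc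
    have := mul_le_mul_of_nonneg_right hc' (Real.log_natCast_nonneg n)
    refine le_of_mul_le_mul_right ?_ (by linarith : 0 < y)
    linarith
  have hsmall : (Nat.lcmUpto Y : ℝ) ≤ Real.exp y ^ 12 := by
    have hpos : (0 : ℝ) < Nat.lcmUpto Y := by exact_mod_cast Nat.lcmUpto_pos Y
    rw [← Real.exp_nat_mul, ← Real.log_le_iff_le_exp hpos, ← Chebyshev.psi_eq_log_lcmUpto]
    refine (Chebyshev.psi_le_const_mul_self (Nat.cast_nonneg Y)).trans ?_
    have h4 : Real.log 4 ≤ 2 := by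
      rw [show (4 : ℝ) = 2 ^ 2 by norm_num, Real.log_pow]
      have := Real.log_two_lt_d9
      push_cast
      linarith
    push_cast
    nlinarith
  have hle : D.lcm id ≤ Nat.lcmUpto Y * n ^ F.card :=
    (Nat.le_of_dvd (Nat.mul_pos (Nat.lcmUpto_pos Y) (Finset.prod_pos fun d hd =>
      (Nat.zero_le _).trans_lt (Finset.mem_filter.1 hd).2)) (lcm_dvd_lcmUpto_mul D Y hD)).trans
      (Nat.mul_le_mul_left _ hprod)
  calc ((D.lcm id : ℕ) : ℝ) ≤ Nat.lcmUpto Y * (n : ℝ) ^ F.card := by exact_mod_cast hle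
    _ ≤ Real.exp y ^ 12 * Real.exp y := by gcongr
    _ = Real.exp y ^ 13 := by ring

theorem walkPeriod_le_exp (hn : 2 ≤ n) (E : Fin n → Fin n → Prop) :
    (walkPeriod E : ℝ) ≤ Real.exp √(n * Real.log n) ^ 15 := by
  have h2 : 2 ≤ Real.exp √(n * Real.log n) := by
    have := Real.add_one_le_exp √(n * Real.log n)
    have := one_le_sqrt_mul_log hn
    linarith
  have hsum : ∑ d ∈ cycleLengths E, d ≤ n := by simpa using sum_cycleLengths_le (E := E)
  have hlcm := lcm_le_exp_of_sum_le hn (D := cycleLengths E) (Finset.notMem_erase _ _) hsum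
  have hnG := natCast_le_exp_sqrt hn
  rw [walkPeriod, Fintype.card_fin]
  push_cast
  calc _ ≤ Real.exp √(n * Real.log n) ^ 13 *
        (Real.exp √(n * Real.log n) * Real.exp √(n * Real.log n)) := by gcongr
    _ = _ := by ring

/-- The language of least words of an `n`-state automaton has few left quotients. -/
theorem exists_recognizedByDFA_minWords_le {α : Type*} (r : α → α → Prop) [Std.Trichotomous r]
    (hn : 2 ≤ n) {L : Language α} (hL : RecognizedByDFA L n) :
    ∃ m : ℕ, (m : ℝ) ≤ 2 ^ (67 / Real.log 2 * √(n * Real.log n)) ∧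
      RecognizedByDFA (minWords r L) m := by
  obtain ⟨M, rfl⟩ := hL
  obtain ⟨p, N, m, hp, rfl, hm, hrec⟩ := exists_recognizedByDFA_minWords r (by omega) M
  refine ⟨m, ?_, hrec⟩
  have hpG : (p : ℝ) ≤ _ := hp ▸ walkPeriod_le_exp hn _
  have hnG := natCast_le_exp_sqrt hn
  have h2 : 2 ≤ Real.exp √(n * Real.log n) := by
    have := Real.add_one_le_exp √(n * Real.log n)
    have := one_le_sqrt_mul_log hn
    linarith
  have hexp : (2 : ℝ) ^ (67 / Real.log 2 * √(n * Real.log n)) = Real.exp √(n * Real.log n) ^ 67 := by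
    have := (Real.log_pos one_lt_two).ne'
    rw [Real.rpow_def_of_pos two_pos, ← Real.exp_nat_mul]
    congr 1
    rw [div_mul_eq_mul_div, mul_div_cancel₀ _ this]
    norm_num
  rw [hexp]
  -- Everything is measured in powers of `G`. As `G ≥ 2`, a sum of two terms costs one extra factor;
  -- two such sums take 65 to 67.
  set G := Real.exp √(n * Real.log n)
  have h1 : 1 ≤ G := by linarith
  have hdouble : ∀ {x z : ℝ} {k : ℕ}, x ≤ G ^ k → z ≤ G ^ k → x + z ≤ G ^ (k + 1) := by
    intro x z k hx hz
    calc x + z ≤ G ^ k * 2 := by linarith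
      _ ≤ G ^ k * G := by gcongr
      _ = G ^ (k + 1) := (pow_succ G k).symm
  have hp1 : (p : ℝ) + 1 ≤ G ^ 16 := hdouble hpG (one_le_pow₀ h1)
  have hN : ((p : ℝ) + 1) * n ≤ G ^ 17 := by
    calc _ ≤ G ^ 16 * G := by gcongr
      _ = _ := by ring
  have hNp : ((p : ℝ) + 1) * n + p ≤ G ^ 18 :=
    hdouble hN (hpG.trans (pow_le_pow_right₀ h1 (by norm_num)))
  have hm' : (m : ℝ) ≤ 1 + (((p + 1) * n) * ((p + 1) * n + p) +
      n * (p * (p * ((p + 1) * ((p + 1) * n + p))))) := by exact_mod_cast hm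
  refine hm'.trans ?_
  have ha : ((p : ℝ) + 1) * n * ((p + 1) * n + p) ≤ G ^ 65 := by
    calc _ ≤ G ^ 17 * G ^ 18 := by gcongr
      _ = G ^ 35 := by ring
      _ ≤ G ^ 65 := pow_le_pow_right₀ h1 (by norm_num)
  have hb : (n : ℝ) * (p * (p * ((p + 1) * ((p + 1) * n + p)))) ≤ G ^ 65 := by
    calc _ ≤ G * (G ^ 15 * (G ^ 15 * (G ^ 16 * G ^ 18))) := by gcongr
      _ = G ^ 65 := by ring
  rw [add_comm]
  exact hdouble (hdouble ha hb) (one_le_pow₀ h1)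

/-! ### Choice of the primes -/

/-- There are many primes between `√x` and `x`. -/
theorem exists_primes_card_eq {x k : ℕ} (hx : 100 ≤ x) (hlog : Real.log x ≤ √x / 100)
    (hk : (k : ℝ) * (2 * Real.log x) ≤ x) :
    ∃ S : Finset ℕ, S.card = k ∧ ∀ p ∈ S, p.Prime ∧ p ≤ x ∧ x < p * p := by
  have hx' : (100 : ℝ) ≤ x := by exact_mod_cast hx
  have hlogpos : 0 < Real.log x := Real.log_pos (by linarith)
  have hsx : √x * √x = x := Real.mul_self_sqrt (by linarith)
  have hs1 : 1 ≤ √(x : ℝ) := by rw [Real.one_le_sqrt]; linarith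
  have hlog1 : Real.log (x + 1) ≤ 2 * Real.log x := by
    rw [← Real.log_rpow (by linarith)]
    refine Real.log_le_log (by linarith) ?_
    norm_num
    nlinarith
  have hpi := Chebyshev.pi_ge x
  rw [div_le_iff₀ hlogpos] at hpi
  let T := (Nat.primesLE x).filter fun p => x < p * p
  have hT : Nat.primeCounting x ≤ T.card + Nat.sqrt x := by
    have h₁ : ((Nat.primesLE x).filter fun p => ¬ x < p * p).card ≤ Nat.sqrt x := by
      refine (Finset.card_le_card (t := Finset.Icc 1 (Nat.sqrt x)) fun p hp => ?_).trans (by simp)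
      rw [Finset.mem_filter] at hp
      exact Finset.mem_Icc.2 ⟨(Nat.prime_of_mem_primesLE hp.1).one_le, Nat.le_sqrt.2 (not_lt.1 hp.2)⟩
    have h₂ := Finset.card_filter_add_card_filter_not (s := Nat.primesLE x) fun p => x < p * p
    have h₃ : (Nat.primesLE x).card = Nat.primeCounting x := by simp
    change _ ≤ ((Nat.primesLE x).filter fun p => x < p * p).card + _
    omega
  have hsqrt : (Nat.sqrt x : ℝ) ≤ √x := Real.nat_sqrt_le_real_sqrt
  have hT' : (Nat.primeCounting x : ℝ) ≤ T.card + Nat.sqrt x := by exact_mod_cast hT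
  have hkT : k ≤ T.card := by
    rw [← Nat.cast_le (α := ℝ)]
    have := Real.log_two_gt_d9
    refine le_of_mul_le_mul_right ?_ hlogpos
    have h₁ := mul_le_mul_of_nonneg_right (hT'.trans (add_le_add_right hsqrt _)) hlogpos.le
    have h₂ := mul_le_mul_of_nonneg_left hlog (Real.sqrt_nonneg x)
    nlinarith
  obtain ⟨S, hS, hcard⟩ := Finset.exists_subset_card_eq hkT
  refine ⟨S, hcard, fun p hp => ?_⟩
  have := Finset.mem_filter.1 (hS hp)
  exact ⟨Nat.prime_of_mem_primesLE this.1, Nat.le_of_mem_primesLE this.1, this.2⟩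

theorem exists_primes_of_le {n x : ℕ} (hn : 4 ≤ n) (hx : 100 ≤ x) (hlog : Real.log x ≤ √x / 100)
    (hx₁ : √(n * Real.log n) ≤ 2 * x) (hx₂ : (x : ℝ) ≤ √(n * Real.log n)) (hnx : n ≤ x * x) :
    ∃ (k : ℕ) (p : Fin k → ℕ), (∀ i, (p i).Prime) ∧ Function.Injective p ∧
      k + 2 + ∑ i, p i ≤ n ∧ Real.exp (√(n * Real.log n) / 64) ≤ ∏ i, p i := by
  have hx' : (100 : ℝ) ≤ x := by exact_mod_cast hx
  have hn' : (4 : ℝ) ≤ n := by exact_mod_cast hn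
  have hlogx : 0 < Real.log x := Real.log_pos (by linarith)
  have hlogn : 0 < Real.log n := Real.log_pos (by linarith)
  have hlognx : Real.log n ≤ 2 * Real.log x := by
    have : Real.log n ≤ Real.log (x * x) :=
      Real.log_le_log (by linarith) (by exact_mod_cast hnx)
    rwa [Real.log_mul (by linarith) (by linarith), ← two_mul] at this
  have hxx : (x : ℝ) * x ≤ n * Real.log n :=
    (mul_self_le_mul_self (by linarith) hx₂).trans_eq (Real.mul_self_sqrt (by positivity))
  have hsqrt : √(x : ℝ) ≤ x := by
    rw [Real.sqrt_le_left (by linarith)]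
    nlinarith
  -- With `log n ≤ 2 * log x` and `x² ≤ n * log n`, this `k` gives `4 * k * x ≤ n`, leaving room for
  -- the `k + 2` other states. Since each prime exceeds `√x`, the product is at least `exp (k * log
  -- x / 2)`, about `exp (x / 16)`.
  set k := ⌊(x : ℝ) / (8 * Real.log x)⌋₊
  have hk₁ : (k : ℝ) * (8 * Real.log x) ≤ x :=
    (le_div_iff₀ (by positivity)).1 (Nat.floor_le (by positivity))
  have hk₂ : (x : ℝ) ≤ (k + 1) * (8 * Real.log x) :=
    ((div_lt_iff₀ (by positivity)).1 (Nat.lt_floor_add_one _)).le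
  obtain ⟨S, hcard, hS⟩ := exists_primes_card_eq hx hlog (k := k) (by nlinarith)
  let e := S.equivFinOfCardEq hcard
  refine ⟨k, fun i => e.symm i, fun i => (hS _ (e.symm i).2).1,
    Subtype.val_injective.comp e.symm.injective, ?_, ?_⟩
  · have hsum : ∑ i, (e.symm i : ℕ) ≤ k * x := by
      simpa using Finset.sum_le_card_nsmul Finset.univ (fun i => (e.symm i : ℕ)) x
        fun i _ => (hS _ (e.symm i).2).2.1
    have hkx : (4 : ℝ) * (k * x) ≤ n := by
      refine le_of_mul_le_mul_right ?_ hlogn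
      have h₁ : (k : ℝ) * (4 * Real.log n) ≤ x :=
        (mul_le_mul_of_nonneg_left (by linarith) (Nat.cast_nonneg k)).trans hk₁
      have := mul_le_mul_of_nonneg_right h₁ (Nat.cast_nonneg x)
      nlinarith
    have hkx' : 4 * (k * x) ≤ n := by exact_mod_cast hkx
    have : k ≤ k * x := Nat.le_mul_of_pos_right _ (by omega)
    change k + 2 + ∑ i, (e.symm i : ℕ) ≤ n
    omega
  · have hprod : Real.exp (Real.log x / 2) ^ k ≤ ∏ i : Fin k, ((e.symm i : ℕ) : ℝ) := by
      conv_lhs => rw [← Fintype.card_fin k, ← Finset.card_univ, ← Finset.prod_const]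
      refine Finset.prod_le_prod (fun _ _ => (Real.exp_pos _).le) fun i _ => ?_
      have h := hS _ (e.symm i).2
      have hpos : (0 : ℝ) < (e.symm i : ℕ) := by exact_mod_cast h.1.pos
      rw [← Real.le_log_iff_exp_le hpos]
      have : Real.log x ≤ Real.log ((e.symm i : ℕ) * (e.symm i : ℕ)) :=
        Real.log_le_log (by linarith) (by exact_mod_cast h.2.2.le)
      rw [Real.log_mul hpos.ne' hpos.ne'] at this
      linarith
    push_cast
    refine le_trans ?_ hprod
    rw [← Real.exp_nat_mul, Real.exp_le_exp]
    linarith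

open Filter in
theorem eventually_exists_primes :
    ∀ᶠ n : ℕ in atTop, ∃ (k : ℕ) (p : Fin k → ℕ), (∀ i, (p i).Prime) ∧ Function.Injective p ∧
      k + 2 + ∑ i, p i ≤ n ∧ Real.exp (√(n * Real.log n) / 64) ≤ ∏ i, p i := by
  have hsqrt : Tendsto (fun n : ℕ => √(n : ℝ)) atTop atTop :=
    Real.tendsto_sqrt_atTop.comp tendsto_natCast_atTop_atTop
  have hlogn : ∀ᶠ n : ℕ in atTop, 4 ≤ Real.log n :=
    (Real.tendsto_log_atTop.comp tendsto_natCast_atTop_atTop).eventually_ge_atTop 4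
  have hle : ∀ᶠ n : ℕ in atTop, 2 * √(n : ℝ) ≤ √(n * Real.log n) := hlogn.mono fun n hn => by
    rw [Real.sqrt_mul (Nat.cast_nonneg n), mul_comm]
    refine mul_le_mul_of_nonneg_left (Real.le_sqrt_of_sq_le ?_) (Real.sqrt_nonneg _)
    linarith
  have hfloor : Tendsto (fun n : ℕ => ⌊√(n * Real.log n)⌋₊) atTop atTop :=
    tendsto_nat_floor_atTop.comp (tendsto_atTop_mono' _ (hle.mono fun n hn => by
      have := Real.sqrt_nonneg (n : ℝ)
      change √(n : ℝ) ≤ _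
      linarith) hsqrt)
  have hsmall : ∀ᶠ x : ℕ in atTop, Real.log x ≤ √x / 100 := by
    have := (isLittleO_log_rpow_atTop (r := 1 / 2) (by norm_num)).bound
      (show (0 : ℝ) < 1 / 100 by norm_num)
    filter_upwards [tendsto_natCast_atTop_atTop.eventually this] with x hx
    rw [← Real.sqrt_eq_rpow, Real.norm_of_nonneg (Real.log_natCast_nonneg x),
      Real.norm_of_nonneg (Real.sqrt_nonneg _)] at hx
    linarith
  filter_upwards [hle, hsqrt.eventually_ge_atTop 1, eventually_ge_atTop 4,
    hfloor.eventually_ge_atTop 100, hfloor.eventually hsmall] with n h₁ h₂ h₃ h₄ h₅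
  have hlt := Nat.lt_floor_add_one √(n * Real.log n)
  refine exists_primes_of_le h₃ h₄ h₅ (by linarith) (Nat.floor_le (Real.sqrt_nonneg _)) ?_
  have h₆ : √(n : ℝ) ≤ ⌊√(n * Real.log n)⌋₊ := by linarith
  have := mul_self_le_mul_self (Real.sqrt_nonneg _) h₆
  rw [Real.mul_self_sqrt (Nat.cast_nonneg n)] at this
  exact_mod_cast this

end Growth

/-! ### Assembling the bounds -/

/-- Automata for the languages of least words may need many states. -/
theorem exists_forall_language_rpow_le :
    ∃ c : ℝ, 0 < c ∧ ∀ {α : Type*} {r : α → α → Prop} [Std.Irrefl r] {a b a₀ : α}, a ≠ b → r a b →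
      (∀ x, ¬ r x a₀) → ∀ n : ℕ, 2 ≤ n → ∃ L : Language α, RecognizedByDFA L n ∧
        ∀ m : ℕ, RecognizedByDFA (minWords r L) m ∨ RecognizedByNFA (minWords r L) m →
          (2 : ℝ) ^ (c * √(n * Real.log n)) ≤ m := by
  obtain ⟨n₀, hn₀⟩ := Filter.eventually_atTop.1 eventually_exists_primes
  -- The second term handles `n < n₀`: it makes the exponent at most 1, so the bound of two states
  -- is enough.
  have hc : 0 < min (1 / 64) (1 / (n₀ + 1 : ℝ)) := lt_min (by norm_num) (by positivity)
  refine ⟨_, hc, fun {α r _ a b a₀} hab hr ha₀ n hn => ?_⟩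
  have hy := one_le_sqrt_mul_log hn
  suffices ∃ L : Language α, RecognizedByDFA L n ∧ ∀ m : ℕ, RecognizedByNFA (minWords r L) m →
      (2 : ℝ) ^ (min (1 / 64) (1 / (n₀ + 1 : ℝ)) * √(n * Real.log n)) ≤ m by
    obtain ⟨L, hL, h⟩ := this
    exact ⟨L, hL, fun m hm => h m (hm.elim RecognizedByDFA.nfa id)⟩
  rcases Nat.lt_or_ge n n₀ with hlt | hge
  · obtain ⟨L, hL, h⟩ := exists_language_two_le ha₀ hn
    refine ⟨L, hL, fun m hm => ?_⟩
    have hyn : √(n * Real.log n) ≤ n₀ + 1 := by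
      have hlt' : (n : ℝ) ≤ n₀ := by exact_mod_cast hlt.le
      refine (Real.sqrt_le_left (by positivity)).2 ?_
      have := Real.log_le_self (Nat.cast_nonneg (α := ℝ) n)
      have := Real.log_natCast_nonneg n
      nlinarith
    have h1 : min (1 / 64) (1 / (n₀ + 1 : ℝ)) * √(n * Real.log n) ≤ 1 := calc
      _ ≤ 1 / (n₀ + 1 : ℝ) * (n₀ + 1) := by gcongr; exact min_le_right _ _
      _ = 1 := by field_simp
    calc (2 : ℝ) ^ (min (1 / 64) (1 / (n₀ + 1 : ℝ)) * √(n * Real.log n))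
        ≤ 2 ^ (1 : ℝ) := Real.rpow_le_rpow_of_exponent_le one_le_two h1
      _ = (2 : ℕ) := by simp
      _ ≤ m := by exact_mod_cast h m hm
  · classical
    obtain ⟨k, p, hprime, hinj, hsum, hprod⟩ := hn₀ n hge
    obtain ⟨L, hL, h⟩ := exists_language_prod_le hab hr (fun i => (hprime i).pos)
      (fun i j hij => (Nat.coprime_primes (hprime i) (hprime j)).2 (hinj.ne hij)) hsum
    refine ⟨L, hL, fun m hm => ?_⟩
    have hm' : ((∏ i, p i : ℕ) : ℝ) ≤ m := by exact_mod_cast h m hm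
    refine le_trans ?_ (hprod.trans hm')
    rw [Real.rpow_def_of_pos two_pos, Real.exp_le_exp]
    have := Real.log_two_lt_d9
    have hle := min_le_left (1 / 64) (1 / (n₀ + 1 : ℝ))
    calc Real.log 2 * (min (1 / 64) (1 / (n₀ + 1 : ℝ)) * √(n * Real.log n))
        ≤ 1 * (1 / 64 * √(n * Real.log n)) := by gcongr; linarith
      _ = √(n * Real.log n) / 64 := by ring

theorem mainTheorem3 :
    ∃ c C : ℝ, 0 < c ∧ 0 < C ∧
      ∀ (α : Type*) [Fintype α] [LinearOrder α] (n : ℕ), 2 ≤ n →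
        -- sufficiency, for every language recognized by a DFA with `n` states
        (∀ L : Language α, RecognizedByDFA L n →
          (∃ m : ℕ, (m : ℝ) ≤ 2 ^ (C * √(n * Real.log n)) ∧
            RecognizedByDFA (smallestWords L) m) ∧
          (∃ m : ℕ, (m : ℝ) ≤ 2 ^ (C * √(n * Real.log n)) ∧
            RecognizedByNFA (smallestWords L) m) ∧
          (∃ m : ℕ, (m : ℝ) ≤ 2 ^ (C * √(n * Real.log n)) ∧
            RecognizedByDFA (largestWords L) m) ∧
          (∃ m : ℕ, (m : ℝ) ≤ 2 ^ (C * √(n * Real.log n)) ∧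
            RecognizedByNFA (largestWords L) m)) ∧
        -- necessity, in general, as soon as there are at least two letters
        (Nontrivial α →
          (∃ L : Language α, RecognizedByDFA L n ∧
            ∀ m : ℕ, RecognizedByDFA (smallestWords L) m ∨ RecognizedByNFA (smallestWords L) m →
              (2 : ℝ) ^ (c * √(n * Real.log n)) ≤ m) ∧
          (∃ L : Language α, RecognizedByDFA L n ∧
            ∀ m : ℕ, RecognizedByDFA (largestWords L) m ∨ RecognizedByNFA (largestWords L) m →
              (2 : ℝ) ^ (c * √(n * Real.log n)) ≤ m)) := by
  obtain ⟨c, hc, hlower⟩ := exists_forall_language_rpow_le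
  refine ⟨c, 67 / Real.log 2, hc, div_pos (by norm_num) (Real.log_pos one_lt_two), ?_⟩
  intro α _ _ n hn
  simp only [smallestWords_eq_minWords, largestWords_eq_minWords]
  have : Std.Trichotomous fun a b : α => b < a :=
    ⟨fun a b h₁ h₂ => le_antisymm (not_lt.1 h₁) (not_lt.1 h₂)⟩
  have : Std.Irrefl fun a b : α => b < a := ⟨fun a => lt_irrefl a⟩
  refine ⟨fun L hL => ?_, fun _ => ?_⟩
  · obtain ⟨m, hm, h⟩ := exists_recognizedByDFA_minWords_le (· < ·) hn hL
    obtain ⟨m', hm', h'⟩ := exists_recognizedByDFA_minWords_le (fun a b => b < a) hn hL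
    exact ⟨⟨m, hm, h⟩, ⟨m, hm, h.nfa⟩, ⟨m', hm', h'⟩, ⟨m', hm', h'.nfa⟩⟩
  · obtain ⟨a, b, hab⟩ : ∃ a b : α, a < b :=
      (exists_pair_ne α).elim fun a ⟨b, h⟩ => h.lt_or_gt.elim (fun h => ⟨a, b, h⟩) fun h => ⟨b, a, h⟩
    obtain ⟨x, hx⟩ := Finite.exists_min (id : α → α)
    obtain ⟨y, hy⟩ := Finite.exists_max (id : α → α)
    exact ⟨hlower hab.ne hab (fun z => (hx z).not_gt) n hn,
      hlower hab.ne' hab (fun z => (hy z).not_gt) n hn⟩
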